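/- For a field $F$ let $K_2(F)$ be the second Milnor $K$-group, i.e. the quotient of $F^\times\otimes_{\mathbb Z}F^\times$ by the subgroup generated by all $x\otimes y$ with $x+y=1$; the class of $x\otimes y$ in $K_2(F)/2$ is written $\{x,y\}$. Let $\mathcal O$ be a complete discrete valuation ring of characteristic $0$ in which $2$ is a uniformizer, with fraction field $K$ and residue field $\kappa\simeq\mathbb F_2(\mathfrak a,\mathfrak b)$, the rational function field in two variables $\mathfrak a,\mathfrak b$ over $\mathbb F_2$. Let $a,b\in\mathcal O$ be any lifts of $\mathfrak a,\mathfrak b$ and let $L=K(\sqrt a,\sqrt b,\sqrt 2)$. Then: 1. $L$ is a pseudo-perfect extension of $K$ of level one. That is, $L$ is generated over $K$ by square roots, one for each member, of the members of some pseudo-basis of $K$; here a pseudo-basis of $K$ consists of a lift to $\mathcal O$ of a $2$-basis of $\kappa$ together with a uniformizer of $\mathcal O$. 2. The natural restriction map $\mathrm{Res}_{L/K}\colon K_2(K)/2\to K_2(L)/2$ is not zero. 3. More precisely, $1+a$ and $1+b$ are nonzero in $K$, and $\mathrm{Res}_{L/K}(\{1+a,1+b\})\neq 0$ in $K_2(L)/2$.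 -/

import Mathlib

open scoped TensorProduct

noncomputable section

/-! ## Milnor `K₂` modulo an integer -/

/-- The second Milnor `K`-group of a field `F`: the quotient of `Fˣ ⊗ Fˣ` by the subgroup generated
by all `x ⊗ y` with `x + y = 1`. The group is written additively. -/
def MilnorK2 (F : Type*) [Field F] : Type _ :=
  (Additive Fˣ ⊗[ℤ] Additive Fˣ) ⧸
    AddSubgroup.closure {t : Additive Fˣ ⊗[ℤ] Additive Fˣ |
      ∃ x y : Fˣ, (x : F) + (y : F) = 1 ∧ t = Additive.ofMul x ⊗ₜ[ℤ] Additive.ofMul y}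

instance (F : Type*) [Field F] : AddCommGroup (MilnorK2 F) :=
  inferInstanceAs (AddCommGroup ((Additive Fˣ ⊗[ℤ] Additive Fˣ) ⧸ AddSubgroup.closure _))

/-- The symbol `{x, y}` in `K₂(F)`. -/
def MilnorK2.symbol {F : Type*} [Field F] (x y : Fˣ) : MilnorK2 F :=
  QuotientAddGroup.mk (Additive.ofMul x ⊗ₜ[ℤ] Additive.ofMul y)

/-- The restriction map `K₂(K) → K₂(L)`, induced by `Kˣ → Lˣ` on both tensor factors. -/
def MilnorK2.res (K L : Type*) [Field K] [Field L] [Algebra K L] : MilnorK2 K →+ MilnorK2 L :=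
  QuotientAddGroup.map _ _
    (TensorProduct.map
      (MonoidHom.toAdditive (Units.map (algebraMap K L : K →* L))).toIntLinearMap
      (MonoidHom.toAdditive (Units.map (algebraMap K L : K →* L))).toIntLinearMap).toAddMonoidHom
    (by
      rw [AddSubgroup.closure_le]
      rintro _ ⟨x, y, hxy, rfl⟩
      apply AddSubgroup.subset_closure
      refine ⟨Units.map (algebraMap K L : K →* L) x, Units.map (algebraMap K L : K →* L) y, ?_, rfl⟩
      have h := congrArg (algebraMap K L) hxy
      simpa using h)

/-- `K₂(F)/m`. -/
def MilnorK2Mod (m : ℕ) (F : Type*) [Field F] : Type _ :=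
  MilnorK2 F ⧸ (nsmulAddMonoidHom m : MilnorK2 F →+ MilnorK2 F).range

instance (m : ℕ) (F : Type*) [Field F] : AddCommGroup (MilnorK2Mod m F) :=
  inferInstanceAs (AddCommGroup (MilnorK2 F ⧸ (nsmulAddMonoidHom m : _ →+ MilnorK2 F).range))

/-- The symbol `{x, y}` in `K₂(F)/m`. -/
def MilnorK2Mod.symbol (m : ℕ) {F : Type*} [Field F] (x y : Fˣ) : MilnorK2Mod m F :=
  QuotientAddGroup.mk (MilnorK2.symbol x y)

/-- The restriction map `K₂(K)/m → K₂(L)/m`. -/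
def MilnorK2Mod.res (m : ℕ) (K L : Type*) [Field K] [Field L] [Algebra K L] :
    MilnorK2Mod m K →+ MilnorK2Mod m L :=
  QuotientAddGroup.map _ _ (MilnorK2.res K L)
    (by
      rintro _ ⟨t, rfl⟩
      exact ⟨MilnorK2.res K L t, by simp⟩)

/-! ## Pseudo-perfect extensions -/

/-- A finite family `b` is a `p`-basis of a field `κ` of characteristic `p`: the monomials
`∏ bᵢ ^ eᵢ` with `0 ≤ eᵢ < p` form a basis of `κ` over the subfield `κ ^ p`. -/
def IsPBasis (p : ℕ) {κ : Type*} [Field κ] [CharP κ p] {n : ℕ} (b : Fin n → κ) : Prop :=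
  ∀ x : κ, ∃! c : (Fin n → Fin p) → κ, x = ∑ e, c e ^ p * ∏ i, b i ^ (e i : ℕ)

/-- A finite family is a regular system of parameters of a regular local ring `R`: it generates
the maximal ideal and has `dim R` members. -/
def IsRegularSystemOfParameters {R : Type*} [CommRing R] [IsRegularLocalRing R] {d : ℕ}
    (x : Fin d → R) : Prop :=
  Ideal.span (Set.range x) = IsLocalRing.maximalIdeal R ∧ ringKrullDim R = d

/-- `β` together with `x` is a pseudo-basis of the fraction field of the complete regular local
ring `R` of characteristic zero with residue characteristic `p`: `β` lifts a `p`-basis of the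
residue field and `x` is a regular system of parameters. -/
def IsPseudoBasis (p : ℕ) {R : Type*} [CommRing R] [CharZero R] [IsRegularLocalRing R]
    [IsAdicComplete (IsLocalRing.maximalIdeal R) R] [CharP (IsLocalRing.ResidueField R) p]
    {n d : ℕ} (β : Fin n → R) (x : Fin d → R) : Prop :=
  IsPBasis p (fun i => IsLocalRing.residue R (β i)) ∧ IsRegularSystemOfParameters x

/-- `L` is a pseudo-perfect extension of level `ℓ` of `K = Frac R`: it is generated over `K` by
`p ^ ℓ`-th roots of the members of some pseudo-basis, one root for each member. -/
def IsPseudoPerfect (p ℓ : ℕ) (R K L : Type*) [CommRing R] [CharZero R] [IsRegularLocalRing R]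
    [IsAdicComplete (IsLocalRing.maximalIdeal R) R] [CharP (IsLocalRing.ResidueField R) p]
    [Field K] [Algebra R K] [IsFractionRing R K] [Field L] [Algebra K L] : Prop :=
  ∃ (n d : ℕ) (β : Fin n → R) (x : Fin d → R), IsPseudoBasis p β x ∧
    ∃ (r : Fin n → L) (s : Fin d → L),
      (∀ i, r i ^ p ^ ℓ = algebraMap K L (algebraMap R K (β i))) ∧
      (∀ j, s j ^ p ^ ℓ = algebraMap K L (algebraMap R K (x j))) ∧
      IntermediateField.adjoin K (Set.range r ∪ Set.range s) = ⊤

end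

/-! The pseudo-basis behind the first claim is a, b, 2; the other claims follow from {1 + a, 1 + b}
≠ 0 over L. If this symbol vanished, the cup product of the quadratic characters of 1 + a and 1 + b
would be a coboundary, and 1 + b would be a norm from L(√(1 + a))
(`exists_norm_eq_of_symbol_eq_zero`). Clearing denominators, x² - (1 + a)y² - (1 + b)z² would have a
nontrivial zero over R = O[α, β, ϖ], where α² = a, β² = b, ϖ² = 2.

Modulo ϖ this form is the square of x - (1 + α)y - (1 + β)z. Putting x = ϖt + (1 + α)y + (1 + β)z
and dividing by 2 leaves t² + αy² + βz² + (1 + α)(1 + β)yz modulo ϖ. Since R/ϖ is κ^(1/2), squaring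
carries this to T² + 𝔞Y² + 𝔟Z² + (1 + 𝔞)(1 + 𝔟)YZ over κ (`dvd_of_form_dvd`), which is anisotropic
by descent at 𝔟 + 1 (`mvPolynomial_anisotropic`). So every zero over R is divisible by ϖ, and a
second descent shows that it is trivial (`ternary_anisotropic`). -/

theorem MilnorK2Mod.exists_lift (m : ℕ) {F : Type*} [Field F] {Q : Type*} [AddCommGroup Q]
    (f : Additive Fˣ →+ Additive Fˣ →+ Q) (hm : ∀ q : Q, m • q = 0)
    (hf : ∀ x y : Fˣ, (x : F) + (y : F) = 1 → f (Additive.ofMul x) (Additive.ofMul y) = 0) :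
    ∃ Φ : MilnorK2Mod m F →+ Q, ∀ x y : Fˣ,
      Φ (MilnorK2Mod.symbol m x y) = f (Additive.ofMul x) (Additive.ofMul y) := by
  let f₁ : Additive Fˣ ⊗[ℤ] Additive Fˣ →+ Q :=
    TensorProduct.liftAddHom f (fun r x y => by simp)
  let f₂ : MilnorK2 F →+ Q := QuotientAddGroup.lift _ f₁ (by
    rw [AddSubgroup.closure_le]
    rintro _ ⟨x, y, hxy, rfl⟩
    exact hf x y hxy)
  refine ⟨QuotientAddGroup.lift _ f₂ ?_, fun x y => rfl⟩
  rintro _ ⟨t, rfl⟩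
  simp [hm]

/-! ### Quadratic characters and their cup products -/

namespace QuadraticCocycle

variable {F : Type*} [Field F]

/-- The sign `±1` attached to an element of `ℤ/2`. -/
def sgn (R : Type*) [Ring R] (z : ZMod 2) : R := if z = 0 then 1 else -1

section sgn
variable {R : Type*} [Ring R]

@[simp] theorem sgn_zero : sgn R 0 = 1 := by simp [sgn]

@[simp] theorem sgn_one : sgn R 1 = -1 := by simp [sgn]

theorem zmod_two_cases (z : ZMod 2) : z = 0 ∨ z = 1 := by revert z; decide

theorem sgn_add (z w : ZMod 2) : sgn R (z + w) = sgn R z * sgn R w := by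
  have h : (1 + 1 : ZMod 2) = 0 := by decide
  rcases zmod_two_cases z with rfl | rfl <;> rcases zmod_two_cases w with rfl | rfl <;> simp [h]

theorem sgn_mul_self (z : ZMod 2) : sgn R z * sgn R z = 1 := by
  rcases zmod_two_cases z with rfl | rfl <;> simp

theorem map_sgn {S H : Type*} [Ring S] [FunLike H R S] [RingHomClass H R S] (φ : H) (z : ZMod 2) :
    φ (sgn R z) = sgn S z := by
  rcases zmod_two_cases z with rfl | rfl <;> simp

theorem sgn_mul_right_injective {E : Type*} [Field E] [CharZero E] {r : E} (hr : r ≠ 0)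
    {z w : ZMod 2} (h : sgn E z * r = sgn E w * r) : z = w := by
  have h1 := mul_right_cancel₀ hr h
  have h2 : (1 : E) ≠ -1 := by
    intro h; have : (2 : E) = 0 := by linear_combination h
    exact two_ne_zero this
  rcases zmod_two_cases z with rfl | rfl <;> rcases zmod_two_cases w with rfl | rfl <;>
    simp_all [eq_comm]

theorem exists_eq_sgn_mul {E : Type*} [Field E] {r s : E} (h : s ^ 2 = r ^ 2) :
    ∃ z, s = sgn E z * r := by
  rcases sq_eq_sq_iff_eq_or_eq_neg.mp h with h | h
  · exact ⟨0, by simp [h]⟩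
  · exact ⟨1, by simp [h]⟩

end sgn

/-- The algebraic closure of `F`. -/
local notation "Ω" => AlgebraicClosure F

theorem exists_sq_eq (x : Ω) : ∃ r : Ω, r ^ 2 = x :=
  IsAlgClosed.exists_pow_nat_eq x two_pos

theorem root_ne_zero {x : Fˣ} {r : Ω} (hr : r ^ 2 = algebraMap F Ω x) : r ≠ 0 := by
  rintro rfl
  have : (x : F) = 0 := by simpa using hr.symm
  exact x.ne_zero this

theorem exists_character (x : Fˣ) : ∃ χ : Gal(Ω/F) → ZMod 2, ∀ (r : Ω),
    r ^ 2 = algebraMap F Ω x → ∀ σ, σ r = sgn Ω (χ σ) * r := by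
  obtain ⟨r, hr⟩ := exists_sq_eq (algebraMap F Ω x)
  have h : ∀ σ : Gal(Ω/F), ∃ z, σ r = sgn Ω z * r := fun σ =>
    exists_eq_sgn_mul (by rw [← map_pow, hr, AlgEquiv.commutes])
  choose χ hχ using h
  refine ⟨χ, fun s hs σ => ?_⟩
  obtain ⟨z, rfl⟩ := exists_eq_sgn_mul (hs.trans hr.symm)
  rw [map_mul, map_sgn, hχ]
  ring

/-- The quadratic character of the Galois group that describes its action on the square roots
of `x`. -/
noncomputable def character (x : Fˣ) : Gal(Ω/F) → ZMod 2 := (exists_character x).choose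

theorem character_spec {x : Fˣ} {r : Ω} (hr : r ^ 2 = algebraMap F Ω x) (σ : Gal(Ω/F)) :
    σ r = sgn Ω (character x σ) * r := (exists_character x).choose_spec r hr σ

variable [CharZero F]

theorem character_eq {x : Fˣ} {r : Ω} (hr : r ^ 2 = algebraMap F Ω x) {σ : Gal(Ω/F)} {z : ZMod 2}
    (h : σ r = sgn Ω z * r) : character x σ = z :=
  sgn_mul_right_injective (root_ne_zero hr) ((character_spec hr σ).symm.trans h)

theorem character_one_right (x : Fˣ) : character x (1 : Gal(Ω/F)) = 0 := by
  obtain ⟨r, hr⟩ := exists_sq_eq (algebraMap F Ω x)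
  exact character_eq hr (by simp)

theorem character_mul_left (x y : Fˣ) : character (x * y) = character x + character y := by
  obtain ⟨r, hr⟩ := exists_sq_eq (algebraMap F Ω x)
  obtain ⟨s, hs⟩ := exists_sq_eq (algebraMap F Ω y)
  funext σ
  refine character_eq (r := r * s) (by simp [mul_pow, hr, hs]) ?_
  rw [map_mul, character_spec hr, character_spec hs, Pi.add_apply, sgn_add]
  ring

theorem character_mul_right (x : Fˣ) (σ τ : Gal(Ω/F)) :
    character x (σ * τ) = character x σ + character x τ := by
  obtain ⟨r, hr⟩ := exists_sq_eq (algebraMap F Ω x)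
  refine character_eq hr ?_
  rw [AlgEquiv.mul_apply, character_spec hr, map_mul, map_sgn, character_spec hr, sgn_add]
  ring

/-- The quadratic characters as a homomorphism. -/
noncomputable def characterHom (F : Type*) [Field F] [CharZero F] :
    Additive Fˣ →+ (Gal(AlgebraicClosure F/F) → ZMod 2) :=
  AddMonoidHom.mk' (fun x => character x.toMul) fun x y => character_mul_left x.toMul y.toMul

/-- A function on the Galois group that factors through the action on a finite extension. -/
def IsFiniteLevel (f : Gal(Ω/F) → ZMod 2) : Prop :=
  ∃ E : IntermediateField F Ω, FiniteDimensional F E ∧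
    ∀ σ τ : Gal(Ω/F), (∀ x ∈ E, σ x = τ x) → f σ = f τ

/-- The functions of two variables that are coboundaries of functions of finite level. -/
def coboundaries (F : Type*) [Field F] [CharZero F] :
    AddSubgroup (Gal(AlgebraicClosure F/F) → Gal(AlgebraicClosure F/F) → ZMod 2) where
  carrier := {c | ∃ f : Gal(AlgebraicClosure F/F) → ZMod 2, IsFiniteLevel f ∧
    ∀ σ τ, f (σ * τ) = f σ + f τ + c σ τ}
  zero_mem' := ⟨0, ⟨⊥, inferInstance, fun _ _ _ => rfl⟩, fun _ _ => by simp⟩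
  add_mem' := by
    rintro c d ⟨f, ⟨E, hE, hf⟩, hfc⟩ ⟨g, ⟨E', hE', hg⟩, hgd⟩
    refine ⟨f + g, ⟨E ⊔ E', inferInstance, fun σ τ h => ?_⟩, fun σ τ => ?_⟩
    · rw [Pi.add_apply, Pi.add_apply, hf σ τ fun x hx => h x (le_sup_left (b := E') hx),
        hg σ τ fun x hx => h x (le_sup_right (a := E) hx)]
    · simp only [Pi.add_apply, hfc, hgd]; ring
  neg_mem' := by
    rintro c ⟨f, ⟨E, hE, hf⟩, hfc⟩
    refine ⟨-f, ⟨E, hE, fun σ τ h => by rw [Pi.neg_apply, Pi.neg_apply, hf σ τ h]⟩, fun σ τ => ?_⟩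
    simp only [Pi.neg_apply, hfc]; ring

/-- The cup product of characters. -/
def cup (G : Type*) : (G → ZMod 2) →+ (G → ZMod 2) →+ (G → G → ZMod 2) :=
  AddMonoidHom.mk' (fun f => AddMonoidHom.mk' (fun g σ τ => f σ * g τ)
    fun g h => by funext σ τ; simp [mul_add]) fun f g => by ext h σ τ; simp [add_mul]

/-- With r = √x, the product of t = √(1 + r) and t' = √(1 - r) is a square root of y. An
automorphism sends t to ±t or ±t' according to its action on r, and this sign is the required
cochain. -/
theorem cup_mem_coboundaries {x y : Fˣ} (hxy : (x : F) + (y : F) = 1) :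
    cup _ (character y) (character x) ∈ coboundaries F := by
  classical
  obtain ⟨r, hr⟩ := exists_sq_eq (algebraMap F Ω x)
  obtain ⟨t, ht⟩ := exists_sq_eq (1 + r)
  obtain ⟨t', ht'⟩ := exists_sq_eq (1 - r)
  have hs : (t * t') ^ 2 = algebraMap F Ω y := by
    rw [eq_sub_of_add_eq' hxy, map_sub, map_one, ← hr, mul_pow, ht, ht']; ring
  have h0 := root_ne_zero hs
  have ht0 : t ≠ 0 := left_ne_zero_of_mul h0
  have ht0' : t' ≠ 0 := right_ne_zero_of_mul h0
  have key : ∀ σ : Gal(Ω/F), ∃ z, σ t = sgn Ω z * if character x σ = 0 then t else t' := by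
    intro σ
    apply exists_eq_sgn_mul
    rw [← map_pow, ht, map_add, map_one, character_spec hr]
    rcases zmod_two_cases (character x σ) with h | h <;> simp [h, ht, ht', sub_eq_add_neg]
  choose f hf using key
  have hfu : ∀ σ z, (σ t = sgn Ω z * if character x σ = 0 then t else t') → f σ = z := by
    intro σ z h
    refine sgn_mul_right_injective ?_ ((hf σ).symm.trans h)
    split_ifs <;> assumption
  have hf' : ∀ σ, σ t' = sgn Ω (f σ + character y σ) * if character x σ = 0 then t' else t := by
    intro σ
    have h1 := character_spec hs σ
    rw [map_mul, hf] at h1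
    rw [sgn_add]
    have h2 := sgn_mul_self (R := Ω) (f σ)
    rcases zmod_two_cases (character x σ) with h | h
    · simp only [h, if_true] at h1 ⊢
      apply mul_left_cancel₀ ht0
      linear_combination sgn Ω (f σ) * h1 - t * σ t' * h2
    · simp only [h, one_ne_zero, if_false] at h1 ⊢
      apply mul_left_cancel₀ ht0'
      linear_combination sgn Ω (f σ) * h1 - t' * σ t' * h2
  -- The sign depends only on the images of r and t, hence the finite level.
  refine ⟨f, ⟨IntermediateField.adjoin F {r, t},
    IntermediateField.finiteDimensional_adjoin fun z _ => Algebra.IsIntegral.isIntegral z,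
    fun σ τ h => ?_⟩, fun σ τ => hfu _ _ ?_⟩
  · have hrr := h r (IntermediateField.subset_adjoin _ _ (by simp))
    have htt := h t (IntermediateField.subset_adjoin _ _ (by simp))
    have hc : character x σ = character x τ :=
      character_eq hr (hrr.trans (character_spec hr τ))
    exact hfu σ _ (by rw [htt, hf τ, hc])
  · rw [AlgEquiv.mul_apply, hf τ, map_mul, map_sgn, character_mul_right]
    simp only [cup, AddMonoidHom.mk'_apply]
    rcases zmod_two_cases (character x τ) with h | h
    · simp only [h, if_true, hf σ, add_zero, mul_zero, sgn_add]
      ring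
    · simp only [h, one_ne_zero, if_false, hf' σ, mul_one, sgn_add]
      have h11 : (1 + 1 : ZMod 2) = 0 := by decide
      rcases zmod_two_cases (character x σ) with h' | h' <;> simp [h', h11] <;> ring

theorem cup_mem_of_symbol_eq_zero {x y : Fˣ} (h : MilnorK2Mod.symbol 2 x y = 0) :
    cup _ (character x) (character y) ∈ coboundaries F := by
  let f : Additive Fˣ →+ Additive Fˣ →+ _ ⧸ coboundaries F :=
    ((AddMonoidHom.compHom (QuotientAddGroup.mk' (coboundaries F))).comp
      ((AddMonoidHom.compHom.flip (characterHom F)).comp ((cup _).comp (characterHom F))))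
  have hfv : ∀ x y : Fˣ, f (Additive.ofMul x) (Additive.ofMul y) =
      QuotientAddGroup.mk' (coboundaries F) (cup _ (character x) (character y)) := fun _ _ => rfl
  obtain ⟨Φ, hΦ⟩ := MilnorK2Mod.exists_lift 2 f (fun q => by
    obtain ⟨c, rfl⟩ := QuotientAddGroup.mk'_surjective _ q
    rw [← map_nsmul]
    have : 2 • c = 0 := by
      funext σ τ
      have : (2 : ZMod 2) = 0 := by decide
      simp [this]
    rw [this, map_zero]) (fun x y hxy => by
      rw [hfv, QuotientAddGroup.mk'_apply, QuotientAddGroup.eq_zero_iff]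
      -- The Steinberg relation is symmetric, which absorbs the swapped order of the characters.
      exact cup_mem_coboundaries (by rw [add_comm, hxy]))
  have h1 := hΦ x y
  rw [h, map_zero, hfv] at h1
  exact (QuotientAddGroup.eq_zero_iff _).mp h1.symm

end QuadraticCocycle

/-! ### Hilbert's Theorem 90 and norms from quadratic extensions -/

namespace QuadraticCocycle
variable {F : Type*} [Field F] [CharZero F]
local notation "Ω" => AlgebraicClosure F

/-- Hilbert's Theorem 90 for a sign function of finite level that is multiplicative on the
stabilizer of the square roots of `A`. -/
theorem exists_eigenvector {A : Fˣ} {f : Gal(Ω/F) → ZMod 2} (hf : IsFiniteLevel f)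
    (hmul : ∀ σ τ, character A σ = 0 → f (σ * τ) = f σ + f τ) :
    ∃ w : Ω, w ≠ 0 ∧ ∀ σ, character A σ = 0 → σ w = sgn Ω (f σ) * w := by
  classical
  obtain ⟨E₀, hE₀, hfE⟩ := hf
  obtain ⟨r, hr⟩ := exists_sq_eq (algebraMap F Ω A)
  have := IntermediateField.finiteDimensional_adjoin (K := F) (S := {r}) fun z _ =>
    Algebra.IsIntegral.isIntegral z
  let E₁ : IntermediateField F Ω := E₀ ⊔ IntermediateField.adjoin F {r}
  have hE₁ : FiniteDimensional F E₁ := IntermediateField.finiteDimensional_sup _ _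
  let E : IntermediateField F Ω := IntermediateField.normalClosure F E₁ Ω
  have hle : E₁ ≤ E := E₁.le_normalClosure
  have hfin : FiniteDimensional F E := normalClosure.is_finiteDimensional F E₁ Ω
  have hnorm : Normal F E := normalClosure.normal F E₁ Ω
  have hres : ∀ (σ : Gal(Ω/F)) (x : E), ((σ.restrictNormalHom E x : E) : Ω) = σ x := fun σ x =>
    AlgEquiv.restrictNormal_commutes σ E x
  obtain ⟨s, hs⟩ := (AlgEquiv.restrictNormalHom_surjective (F := F) (K₁ := E) Ω).hasRightInverse
  have hsx : ∀ (γ : Gal(E/F)) (x : E), s γ (x : Ω) = (γ x : E) := fun γ x => by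
    rw [← hres, hs γ]
  have hrE : r ∈ E := hle (le_sup_right (a := E₀) (IntermediateField.subset_adjoin _ _ (by simp)))
  have hagree : ∀ σ τ : Gal(Ω/F), (∀ x : E, σ x = τ x) → character A σ = character A τ ∧
      f σ = f τ := fun σ τ h =>
    ⟨character_eq hr ((h ⟨r, hrE⟩).trans (character_spec hr τ)),
      hfE σ τ fun x hx => h ⟨x, hle (le_sup_left (b := IntermediateField.adjoin F {r}) hx)⟩⟩
  -- Coefficients of a Lagrange resolvent supported on the stabilizer of r; Artin's independence of
  -- automorphisms makes it nonzero at some x.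
  let c : Gal(E/F) → E := fun γ => if character A (s γ) = 0 then sgn E (f (s γ)) else 0
  have hlin : LinearIndependent E (fun γ : Gal(E/F) => (γ : E → E)) :=
    (linearIndependent_monoidHom E E).comp
      (fun γ : Gal(E/F) => ((γ : E →+* E) : E →* E))
      fun γ γ' h => AlgEquiv.ext fun x => DFunLike.congr_fun h x
  have hone : character A (s 1) = 0 := by
    have h := (hagree (s 1) 1 fun x => by rw [hsx]; rfl).1
    rw [h]
    exact character_one_right A
  obtain ⟨x, hx⟩ : ∃ x : E, ∑ γ, c γ * γ x ≠ 0 := by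
    by_contra! h
    have h1 := Fintype.linearIndependent_iff.mp hlin c (by
      funext x
      simpa using h x) 1
    simp only [c, hone, if_true] at h1
    rcases zmod_two_cases (f (s 1)) with h | h <;> simp [h] at h1
  refine ⟨(∑ γ, c γ * γ x : E), by rwa [Ne, ZeroMemClass.coe_eq_zero], fun σ hσ => ?_⟩
  rw [← hres, ← map_sgn (algebraMap E Ω)]
  change algebraMap E Ω _ = _ * algebraMap E Ω _
  rw [← map_mul]
  congr 1
  rw [map_sum, Finset.mul_sum]
  refine Fintype.sum_equiv (Equiv.mulLeft (σ.restrictNormalHom E)) _ _ fun γ => ?_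
  obtain ⟨h1, h2⟩ := hagree (s (σ.restrictNormalHom E * γ)) (σ * s γ) fun x => by
    rw [hsx, AlgEquiv.mul_apply, AlgEquiv.mul_apply, hres, hsx]
  simp only [Equiv.coe_mulLeft, map_mul, c, h1, h2, character_mul_right, hσ, zero_add,
    hmul σ _ hσ, AlgEquiv.mul_apply]
  split_ifs
  · rw [map_sgn, sgn_add, ← mul_assoc, ← mul_assoc, sgn_mul_self, one_mul]
  · simp

theorem mem_range_of_fixed {x : Ω} (h : ∀ σ : Gal(Ω/F), σ x = x) : ∃ y : F, algebraMap F Ω y = x :=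
  IntermediateField.mem_bot.mp ((InfiniteGalois.mem_bot_iff_fixed x).mpr h)

/-- On the kernel H of the character of A the cup product vanishes, so f is a homomorphism there and
has an eigenvector w. For τ outside H, the element γ = τ(w)√B / w is fixed by H, hence lies in
F(√A), and its norm is B. -/
theorem exists_norm_eq {A B : Fˣ}
    (h : cup _ (character A) (character B) ∈ coboundaries F) :
    ∃ X Y : F, X ^ 2 - A * Y ^ 2 = B := by
  obtain ⟨f, hf, hcup⟩ := h
  replace hcup : ∀ σ τ, f (σ * τ) = f σ + f τ + character A σ * character B τ := hcup
  obtain ⟨α, hα⟩ := exists_sq_eq (algebraMap F Ω A)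
  obtain ⟨β, hβ⟩ := exists_sq_eq (algebraMap F Ω B)
  have hα0 := root_ne_zero hα
  have hβ0 := root_ne_zero hβ
  by_cases htriv : ∀ σ, character A σ = 0
  · obtain ⟨y, hy⟩ := mem_range_of_fixed (x := α) fun σ => by
      rw [character_spec hα, htriv, sgn_zero, one_mul]
    have hA : (A : F) = y ^ 2 := (algebraMap F Ω).injective (by rw [map_pow, hy, hα])
    have hy0 : y ≠ 0 := by rintro rfl; simp at hA
    -- When A = y² the norm form is a difference of squares, and B = ((B + 1)/2)² - ((B - 1)/2)².
    refine ⟨(B + 1) / 2, (B - 1) / (2 * y), ?_⟩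
    rw [hA]; field_simp; ring
  · push Not at htriv
    obtain ⟨τ, hτ⟩ := htriv
    replace hτ := (zmod_two_cases _).resolve_left hτ
    have h11 : (1 + 1 : ZMod 2) = 0 := by decide
    obtain ⟨w, hw0, hw⟩ := exists_eigenvector (A := A) hf fun σ τ hσ => by
      rw [hcup, hσ, zero_mul, add_zero]
    have hτinv : character A τ⁻¹ = 1 := by
      have h1 := character_mul_right A τ τ⁻¹
      rw [mul_inv_cancel, hτ, character_one_right] at h1
      linear_combination (-1 : ZMod 2) * h1 - h11
    -- Conjugation by τ changes f on H by the character of B; the factor √B in γ compensates for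
    -- this.
    have hconj : ∀ σ, character A σ = 0 → character A (τ⁻¹ * σ * τ) = 0 ∧
        f (τ⁻¹ * σ * τ) = f σ + character B σ := fun σ hσ => by
      have h0 : character A (τ⁻¹ * σ * τ) = 0 := by
        rw [character_mul_right, character_mul_right, hσ, hτ, hτinv, add_zero, h11]
      refine ⟨h0, ?_⟩
      have h1 := hcup τ (τ⁻¹ * σ * τ)
      rw [show τ * (τ⁻¹ * σ * τ) = σ * τ by group, hcup, hσ, hτ, zero_mul, one_mul,
        character_mul_right, character_mul_right] at h1
      have h2 := character_mul_right B τ⁻¹ τ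
      rw [inv_mul_cancel, character_one_right] at h2
      have h3 : (2 : ZMod 2) = 0 := by decide
      linear_combination (-1 : ZMod 2) * h1 + h2 - character B σ * h3
    let γ : Ω := τ w * β / w
    have hγ : γ * w = τ w * β := div_mul_cancel₀ _ hw0
    have hfix : ∀ σ, character A σ = 0 → σ γ = γ := fun σ hσ => by
      have h1 : σ (τ w) = τ ((τ⁻¹ * σ * τ) w) := by
        rw [← AlgEquiv.mul_apply, ← AlgEquiv.mul_apply]; congr 1; group
      have h2 := sgn_mul_self (R := Ω) (f σ)
      have h3 := sgn_mul_self (R := Ω) (character B σ)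
      simp only [γ]
      rw [map_div₀, map_mul, h1, hw _ (hconj σ hσ).1, (hconj σ hσ).2, hw σ hσ,
        character_spec hβ, map_mul, map_sgn, sgn_add]
      have hs : sgn Ω (f σ) ≠ 0 := left_ne_zero_of_mul_eq_one h2
      rw [div_eq_div_iff (mul_ne_zero hs hw0) hw0]
      linear_combination (sgn Ω (f σ) * τ w * β * w) * h3
    have hfix' : ∀ σ, character A σ = 1 → σ γ = τ γ := fun σ hσ => by
      have h1 := hfix (τ⁻¹ * σ) (by rw [character_mul_right, hσ, hτinv, h11])
      rw [← congrArg τ h1, ← AlgEquiv.mul_apply, mul_inv_cancel_left]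
    have hττ : τ (τ γ) = γ := hfix (τ * τ) (by rw [character_mul_right, hτ, h11])
    have hBγ : algebraMap F Ω B = γ * τ γ := by
      have h1 : τ (τ w) = sgn Ω (character B τ) * w := by
        have := hw (τ * τ) (by rw [character_mul_right, hτ, h11])
        rw [AlgEquiv.mul_apply, hcup, hτ, one_mul, sgn_add, sgn_add, sgn_mul_self, one_mul] at this
        exact this
      have h2 := congrArg τ hγ
      rw [map_mul, map_mul, h1, character_spec hβ] at h2
      have h3 := sgn_mul_self (R := Ω) (character B τ)
      apply mul_right_cancel₀ hw0
      linear_combination (-w) * hβ - w * β ^ 2 * h3 - β * h2 - τ γ * hγ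
    -- X and Y are the coordinates of γ in the basis 1, α of F(√A).
    obtain ⟨X, hX⟩ := mem_range_of_fixed (x := (γ + τ γ) / 2) fun σ => by
      rcases zmod_two_cases (character A σ) with h | h
      · have h' : σ (τ γ) = τ γ := by
          rw [← AlgEquiv.mul_apply]
          exact hfix' _ (by rw [character_mul_right, h, hτ, zero_add])
        rw [map_div₀, map_add, hfix σ h, h', map_ofNat]
      · have h' : σ (τ γ) = γ := by
          rw [← AlgEquiv.mul_apply]
          exact hfix _ (by rw [character_mul_right, h, hτ, h11])
        rw [map_div₀, map_add, hfix' σ h, h', map_ofNat, add_comm]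
    obtain ⟨Y, hY⟩ := mem_range_of_fixed (x := (γ - τ γ) / (2 * α)) fun σ => by
      rw [map_div₀, map_sub, map_mul, map_ofNat, character_spec hα]
      rcases zmod_two_cases (character A σ) with h | h
      · have h' : σ (τ γ) = τ γ := by
          rw [← AlgEquiv.mul_apply]
          exact hfix' _ (by rw [character_mul_right, h, hτ, zero_add])
        rw [hfix σ h, h', h, sgn_zero, one_mul]
      · have h' : σ (τ γ) = γ := by
          rw [← AlgEquiv.mul_apply]
          exact hfix _ (by rw [character_mul_right, h, hτ, h11])
        rw [hfix' σ h, h', h, sgn_one]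
        field_simp
        ring
    refine ⟨X, Y, (algebraMap F Ω).injective ?_⟩
    rw [map_sub, map_mul, map_pow, map_pow, hX, hY, hBγ, ← hα]
    field_simp
    ring

/-- If `{A, B} = 0` in `K₂(F)/2`, then `B` is a norm from `F(√A)`. -/
theorem exists_norm_eq_of_symbol_eq_zero {A B : Fˣ} (h : MilnorK2Mod.symbol 2 A B = 0) :
    ∃ X Y : F, X ^ 2 - A * Y ^ 2 = B :=
  exists_norm_eq (cup_mem_of_symbol_eq_zero h)

end QuadraticCocycle

/-- Infinite descent: a homogeneous condition that forces divisibility by a fixed nonunit has only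
the zero solution. -/
theorem eq_zero_of_descent {R ι : Type*} [CommRing R] [IsDomain R] [WfDvdMonoid R] {q : R}
    (hq : ¬ IsUnit q) {P : (ι → R) → Prop}
    (h : ∀ x, P x → ∃ y, (∀ i, x i = q * y i) ∧ P y) {x : ι → R} (hx : P x) (i : ι) : x i = 0 := by
  have hdvd : ∀ n : ℕ, ∀ x, P x → ∀ i, q ^ n ∣ x i := by
    intro n
    induction n with
    | zero => simp
    | succ n ih =>
      intro x hx i
      obtain ⟨y, hy, hPy⟩ := h x hx
      rw [hy, pow_succ']
      exact mul_dvd_mul_left q (ih y hPy i)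
  by_contra h0
  obtain ⟨n, hn⟩ := FiniteMultiplicity.of_not_isUnit hq h0
  exact hn (hdvd _ x hx i)

/-! ### Quadratic forms and the 2-basis over 𝔽₂(𝔞, 𝔟) -/

namespace RationalFunctions

open MvPolynomial

theorem two_eq_zero_mvPolynomial : (2 : MvPolynomial (Fin 2) (ZMod 2)) = 0 :=
  CharTwo.two_eq_zero

/-- In one variable, `X + d` is not a quotient of squares. -/
theorem polynomial_eq_zero {d : ZMod 2} {s t : Polynomial (ZMod 2)}
    (h : s ^ 2 + (Polynomial.X + Polynomial.C d) * t ^ 2 = 0) : s = 0 ∧ t = 0 := by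
  have h1 : s ^ 2 = (Polynomial.X + Polynomial.C d) * t ^ 2 := CharTwo.add_eq_zero.mp h
  have ht : t = 0 := by
    by_contra ht
    -- The left side has even degree, the right side odd degree.
    have h2 := congrArg Polynomial.natDegree h1
    rw [Polynomial.natDegree_pow, (Polynomial.monic_X_add_C d).natDegree_mul' (pow_ne_zero 2 ht),
      Polynomial.natDegree_pow, Polynomial.natDegree_X_add_C] at h2
    omega
  subst ht
  exact ⟨by simpa using h1, rfl⟩

/-- Reduction modulo `X₁ + c`. -/
noncomputable def red (c : ZMod 2) : MvPolynomial (Fin 2) (ZMod 2) →ₐ[ZMod 2] Polynomial (ZMod 2) :=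
  aeval ![Polynomial.X, Polynomial.C c]

theorem red_X_zero (c : ZMod 2) : red c (X 0) = Polynomial.X := by simp [red]

theorem red_X_one_add (c : ZMod 2) : red c (X 1 + C c) = 0 := by
  simp [red, CharTwo.add_self_eq_zero]

/-- Modulo X₁ + c a polynomial is congruent to its reduction, as can be checked on the variables; X₁
≡ c because signs do not matter. -/
theorem dvd_of_red_eq_zero {c : ZMod 2} {f : MvPolynomial (Fin 2) (ZMod 2)} (h : red c f = 0) :
    X 1 + C c ∣ f := by
  rw [← Ideal.mem_span_singleton, ← Ideal.Quotient.eq_zero_iff_mem]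
  let I : Ideal (MvPolynomial (Fin 2) (ZMod 2)) := Ideal.span {X 1 + C c}
  have key : Ideal.Quotient.mkₐ (ZMod 2) I =
      ((Ideal.Quotient.mkₐ (ZMod 2) I).comp (Polynomial.aeval (X 0))).comp (red c) := by
    refine algHom_ext fun i => ?_
    fin_cases i
    · simp [red]
    · have h1 : Ideal.Quotient.mk I (X 1 + C c) = 0 :=
        Ideal.Quotient.eq_zero_iff_mem.mpr (Ideal.mem_span_singleton_self _)
      have h2 : Ideal.Quotient.mk I (X 1 - C c) = 0 := by rwa [CharTwo.sub_eq_add]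
      rw [map_sub, sub_eq_zero] at h2
      simpa [red] using h2
  have := DFunLike.congr_fun key f
  simpa [h] using this

theorem X_one_add_ne_zero (c : ZMod 2) : (X 1 + C c : MvPolynomial (Fin 2) (ZMod 2)) ≠ 0 := by
  intro h
  have h1 := congrArg (aeval (R := ZMod 2) (![0, Polynomial.X] : Fin 2 → Polynomial (ZMod 2))) h
  simp only [map_add, aeval_X, aeval_C, map_zero] at h1
  exact Polynomial.X_add_C_ne_zero c h1

theorem not_isUnit_X_one_add (c : ZMod 2) :
    ¬ IsUnit (X 1 + C c : MvPolynomial (Fin 2) (ZMod 2)) := fun h => by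
  have := h.map (red c)
  rw [red_X_one_add] at this
  exact not_isUnit_zero this

theorem dvd_of_dvd_sq_add {c d : ZMod 2} {s t : MvPolynomial (Fin 2) (ZMod 2)}
    (h : X 1 + C c ∣ s ^ 2 + (X 0 + C d) * t ^ 2) : X 1 + C c ∣ s ∧ X 1 + C c ∣ t := by
  have h1 : red c (s ^ 2 + (X 0 + C d) * t ^ 2) = 0 := by
    obtain ⟨u, hu⟩ := h
    rw [hu, map_mul, red_X_one_add, zero_mul]
  have h2 : red c (C d) = Polynomial.C d := by simp [red]
  rw [map_add, map_mul, map_add, red_X_zero, h2, map_pow, map_pow] at h1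
  obtain ⟨h3, h4⟩ := polynomial_eq_zero h1
  exact ⟨dvd_of_red_eq_zero h3, dvd_of_red_eq_zero h4⟩

/-- The quadratic form `x² + a y² + b z² + (1 + a)(1 + b) y z` is anisotropic over `𝔽₂[a, b]`. -/
theorem mvPolynomial_anisotropic {f : Fin 3 → MvPolynomial (Fin 2) (ZMod 2)}
    (h : f 0 ^ 2 + X 0 * f 1 ^ 2 + X 1 * f 2 ^ 2 + (1 + X 0) * (1 + X 1) * (f 1 * f 2) = 0)
    (i : Fin 3) : f i = 0 := by
  have h2 := two_eq_zero_mvPolynomial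
  refine eq_zero_of_descent (not_isUnit_X_one_add 1) (P := fun f =>
    f 0 ^ 2 + X 0 * f 1 ^ 2 + X 1 * f 2 ^ 2 + (1 + X 0) * (1 + X 1) * (f 1 * f 2) = 0)
    (fun f hf => ?_) h i
  have hq := X_one_add_ne_zero 1
  simp only [map_one] at hq ⊢
  -- In characteristic 2 the first three terms are (f₀ + f₁ + f₂)² + (X₀ + 1)f₁² + (X₁ + 1)f₂².
  obtain ⟨⟨s, hs⟩, t, ht⟩ := dvd_of_dvd_sq_add (c := 1) (d := 1) (s := f 0 + f 1 + f 2) (t := f 1)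
    ⟨f 2 ^ 2 + (1 + X 0) * (f 1 * f 2), by
      simp only [map_one]
      linear_combination (-1) * hf + ((f 0 + f 1 + f 2) ^ 2 + (X 0 + 1) * f 1 ^ 2 -
        f 1 ^ 2 - f 2 ^ 2 - f 0 * f 1 - f 0 * f 2 - f 1 * f 2) * h2⟩
  simp only [map_one] at hs ht
  -- Dividing the equation by X₁ + 1 now leaves f₂² modulo X₁ + 1.
  obtain ⟨u, hu⟩ : X 1 + 1 ∣ f 2 := by
    have := (dvd_of_dvd_sq_add (c := 1) (d := 1) (s := f 2) (t := 0)
      ⟨-(s ^ 2 + (X 0 + 1) * t ^ 2 + (1 + X 0) * (t * f 2)), by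
        apply mul_left_cancel₀ hq
        simp only [map_one]
        linear_combination hf + (f 1 ^ 2 + f 2 ^ 2 + f 0 * f 1 + f 0 * f 2 + f 1 * f 2) * h2 -
          (f 0 + f 1 + f 2 + (X 1 + 1) * s) * hs - (X 0 + 1) * (f 1 + (X 1 + 1) * t) * ht -
          (X 0 + 1) * (X 1 + 1) * f 2 * ht⟩).1
    simpa using this
  refine ⟨![s - t - u, t, u], ?_, ?_⟩
  · intro i
    fin_cases i
    · simp; linear_combination hs - ht - hu
    · simpa using ht
    · simpa using hu
  · simp
    apply mul_left_cancel₀ (pow_ne_zero 2 hq)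
    rw [mul_zero, ← hf, ht, hu, show f 0 = (X 1 + 1) * (s - t - u) by
      linear_combination hs - ht - hu]
    ring

/-- Descent at X₁: reduction modulo X₁ makes f₀ and f₁ divisible, and after division by X₁ the same
argument applies to f₂ and f₃. -/
theorem mvPolynomial_independent {f : Fin 4 → MvPolynomial (Fin 2) (ZMod 2)}
    (h : f 0 ^ 2 + X 0 * f 1 ^ 2 + X 1 * (f 2 ^ 2 + X 0 * f 3 ^ 2) = 0) (i : Fin 4) : f i = 0 := by
  have hq : (X 1 : MvPolynomial (Fin 2) (ZMod 2)) ≠ 0 := X_ne_zero 1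
  have hdvd : ∀ {s t : MvPolynomial (Fin 2) (ZMod 2)}, X 1 ∣ s ^ 2 + X 0 * t ^ 2 →
      X 1 ∣ s ∧ X 1 ∣ t := fun {s t} h => by
    simpa using dvd_of_dvd_sq_add (c := 0) (d := 0) (s := s) (t := t) (by simpa using h)
  refine eq_zero_of_descent (by simpa using not_isUnit_X_one_add 0) (P := fun f =>
    f 0 ^ 2 + X 0 * f 1 ^ 2 + X 1 * (f 2 ^ 2 + X 0 * f 3 ^ 2) = 0) (fun f hf => ?_) h i
  obtain ⟨⟨s, hs⟩, t, ht⟩ := hdvd (s := f 0) (t := f 1)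
    ⟨-(f 2 ^ 2 + X 0 * f 3 ^ 2), by linear_combination hf⟩
  obtain ⟨⟨u, hu⟩, v, hv⟩ := hdvd (s := f 2) (t := f 3) ⟨-(s ^ 2 + X 0 * t ^ 2), by
    apply mul_left_cancel₀ hq
    rw [hs, ht] at hf
    linear_combination hf⟩
  refine ⟨![s, t, u, v], ?_, ?_⟩
  · intro i
    fin_cases i <;> simpa
  · simp
    apply mul_left_cancel₀ (pow_ne_zero 2 hq)
    rw [mul_zero, ← hf, hs, ht, hu, hv]
    ring

/-- Squaring is additive, and multiplication by a variable permutes 1, X₀, X₁, X₀X₁ up to square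
factors. -/
theorem mvPolynomial_exists_squares (f : MvPolynomial (Fin 2) (ZMod 2)) :
    ∃ x y z w, f = x ^ 2 + X 0 * y ^ 2 + X 1 * (z ^ 2 + X 0 * w ^ 2) := by
  have h2 := two_eq_zero_mvPolynomial
  induction f using MvPolynomial.induction_on with
  | C c => exact ⟨C c, 0, 0, 0, by
      rw [← C_pow, show c ^ 2 = c by revert c; decide]; ring⟩
  | add f g hf hg =>
    obtain ⟨x, y, z, w, rfl⟩ := hf
    obtain ⟨x', y', z', w', rfl⟩ := hg
    refine ⟨x + x', y + y', z + z', w + w', ?_⟩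
    linear_combination (-(x * x') - X 0 * y * y' - X 1 * (z * z' + X 0 * w * w')) * h2
  | mul_X f i hf =>
    obtain ⟨x, y, z, w, rfl⟩ := hf
    fin_cases i
    · exact ⟨X 0 * y, x, X 0 * w, z, by simp; ring⟩
    · exact ⟨X 1 * z, X 1 * w, x, y, by simp; ring⟩

theorem sum_fin_two_arrow {κ : Type*} [Field κ] (β : Fin 2 → κ) (c : (Fin 2 → Fin 2) → κ) :
    ∑ e, c e ^ 2 * ∏ i, β i ^ (e i : ℕ) = c ![0, 0] ^ 2 + β 0 * c ![1, 0] ^ 2 +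
      β 1 * (c ![0, 1] ^ 2 + β 0 * c ![1, 1] ^ 2) := by
  rw [← (finTwoArrowEquiv (Fin 2)).symm.sum_comp]
  simp [Fintype.sum_prod_type, finTwoArrowEquiv, Fin.prod_univ_two]
  ring

variable {κ : Type*} [Field κ] [Algebra (MvPolynomial (Fin 2) (ZMod 2)) κ]
  [IsFractionRing (MvPolynomial (Fin 2) (ZMod 2)) κ]

local notation "ι" => algebraMap (MvPolynomial (Fin 2) (ZMod 2)) κ

theorem exists_common_denominator {n : ℕ} (c : Fin n → κ) :
    ∃ g : κ, g ≠ 0 ∧ ∃ f : Fin n → MvPolynomial (Fin 2) (ZMod 2), ∀ i, ι (f i) = g * c i := by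
  obtain ⟨g, hg⟩ := IsLocalization.exist_integer_multiples_of_finite
    (nonZeroDivisors (MvPolynomial (Fin 2) (ZMod 2))) c
  choose f hf using hg
  exact ⟨ι g, IsFractionRing.to_map_ne_zero_of_mem_nonZeroDivisors g.2, f, fun i => by
    rw [hf, Algebra.smul_def]⟩

theorem anisotropic {x y z : κ}
    (h : x ^ 2 + ι (X 0) * y ^ 2 + ι (X 1) * z ^ 2 +
      (1 + ι (X 0)) * (1 + ι (X 1)) * (y * z) = 0) : x = 0 ∧ y = 0 ∧ z = 0 := by
  obtain ⟨g, hg, f, hf⟩ := exists_common_denominator ![x, y, z]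
  have h0 := mvPolynomial_anisotropic (f := f) (by
    apply IsFractionRing.injective _ κ
    simp only [map_add, map_mul, map_pow, map_one, map_zero, hf]
    simp
    linear_combination g ^ 2 * h)
  have h1 : ∀ i, ![x, y, z] i = 0 := fun i => by
    have := hf i
    rw [h0, map_zero, eq_comm, mul_eq_zero] at this
    exact this.resolve_left hg
  exact ⟨h1 0, h1 1, h1 2⟩

theorem independent {x y z w : κ}
    (h : x ^ 2 + ι (X 0) * y ^ 2 + ι (X 1) * (z ^ 2 + ι (X 0) * w ^ 2) = 0) :
    x = 0 ∧ y = 0 ∧ z = 0 ∧ w = 0 := by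
  obtain ⟨g, hg, f, hf⟩ := exists_common_denominator ![x, y, z, w]
  have h0 := mvPolynomial_independent (f := f) (by
    apply IsFractionRing.injective _ κ
    simp only [map_add, map_mul, map_pow, map_zero, hf]
    simp
    linear_combination g ^ 2 * h)
  have h1 : ∀ i, ![x, y, z, w] i = 0 := fun i => by
    have := hf i
    rw [h0, map_zero, eq_comm, mul_eq_zero] at this
    exact this.resolve_left hg
  exact ⟨h1 0, h1 1, h1 2, h1 3⟩

theorem exists_squares (t : κ) :
    ∃ x y z w, t = x ^ 2 + ι (X 0) * y ^ 2 + ι (X 1) * (z ^ 2 + ι (X 0) * w ^ 2) := by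
  obtain ⟨f, g, hg, rfl⟩ := IsFractionRing.div_surjective (A := MvPolynomial (Fin 2) (ZMod 2)) t
  have hg0 : ι g ≠ 0 := IsFractionRing.to_map_ne_zero_of_mem_nonZeroDivisors hg
  -- f/g = fg/g², so only the numerator fg needs to be expanded.
  obtain ⟨x, y, z, w, h⟩ := mvPolynomial_exists_squares (f * g)
  refine ⟨ι x / ι g, ι y / ι g, ι z / ι g, ι w / ι g, ?_⟩
  have := congrArg ι h
  simp only [map_add, map_mul, map_pow] at this
  field_simp
  linear_combination this

theorem isPBasis [CharP κ 2] : IsPBasis 2 (fun i : Fin 2 => ι (X i)) := by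
  intro t
  simp only [sum_fin_two_arrow]
  obtain ⟨x, y, z, w, h⟩ := exists_squares t
  refine ⟨fun e => if e 0 = 0 then (if e 1 = 0 then x else z) else if e 1 = 0 then y else w,
    by simpa using h, fun c hc => ?_⟩
  have h2 : (2 : κ) = 0 := CharTwo.two_eq_zero
  -- Additivity of squaring turns two expansions of t into one relation between the differences of
  -- coefficients.
  obtain ⟨h1, h3, h4, h5⟩ := independent (κ := κ) (x := c ![0, 0] - x) (y := c ![1, 0] - y)
    (z := c ![0, 1] - z) (w := c ![1, 1] - w) (by
      linear_combination h - hc + (x ^ 2 - x * c ![0, 0] + ι (X 0) * (y ^ 2 - y * c ![1, 0]) +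
        ι (X 1) * (z ^ 2 - z * c ![0, 1] + ι (X 0) * (w ^ 2 - w * c ![1, 1]))) * h2)
  funext e
  obtain ⟨⟨i, j⟩, rfl⟩ := (finTwoArrowEquiv (Fin 2)).symm.surjective e
  rw [sub_eq_zero] at h1 h3 h4 h5
  fin_cases i <;> fin_cases j <;> simpa [finTwoArrowEquiv]

end RationalFunctions

/-! ### Descent modulo ϖ, where ϖ² = 2 -/

namespace RationalFunctions

open MvPolynomial IsLocalRing

section Descent

variable {O R : Type*} [CommRing O] [IsLocalRing O]
  [Algebra (MvPolynomial (Fin 2) (ZMod 2)) (ResidueField O)]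
  [IsFractionRing (MvPolynomial (Fin 2) (ZMod 2)) (ResidueField O)]
  (hO : maximalIdeal O = Ideal.span {2})
  {a b : O} (ha : residue O a = algebraMap (MvPolynomial (Fin 2) (ZMod 2)) _ (X 0))
  (hb : residue O b = algebraMap (MvPolynomial (Fin 2) (ZMod 2)) _ (X 1))
  [CommRing R] [Algebra O R] {α β ϖ : R}
  (hα : α ^ 2 = algebraMap O R a) (hβ : β ^ 2 = algebraMap O R b) (hϖ : ϖ ^ 2 = 2)
  (hunit : ¬ IsUnit ϖ)
  (hrep : ∀ r : R, ∃ (x y z w : O) (s : R), r = algebraMap O R x + α * algebraMap O R y +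
    β * (algebraMap O R z + α * algebraMap O R w) + ϖ * s)

omit [Algebra (MvPolynomial (Fin 2) (ZMod 2)) (ResidueField O)]
  [IsFractionRing (MvPolynomial (Fin 2) (ZMod 2)) (ResidueField O)] in
include hunit in
theorem residue_eq_zero_of_dvd {c : O} (h : ϖ ∣ algebraMap O R c) : residue O c = 0 := by
  rw [residue_eq_zero_iff, mem_maximalIdeal, mem_nonunits_iff]
  exact fun hc => hunit (isUnit_of_dvd_unit h (hc.map _))

omit [Algebra (MvPolynomial (Fin 2) (ZMod 2)) (ResidueField O)]
  [IsFractionRing (MvPolynomial (Fin 2) (ZMod 2)) (ResidueField O)] in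
include hO hϖ in
theorem dvd_of_residue_eq_zero {c : O} (h : residue O c = 0) : ϖ ∣ algebraMap O R c := by
  rw [residue_eq_zero_iff, hO, Ideal.mem_span_singleton] at h
  obtain ⟨d, rfl⟩ := h
  exact ⟨ϖ * algebraMap O R d, by rw [map_mul, map_ofNat, ← hϖ]; ring⟩

include hO ha hb hα hβ hϖ hrep in
/-- The squares of elements of `R` are, modulo `ϖ`, elements of `O`. -/
theorem exists_sq_congr (r : R) :
    ∃ c : O, ϖ ∣ r ^ 2 - algebraMap O R c ∧ (residue O c = 0 → ϖ ∣ r) := by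
  obtain ⟨x, y, z, w, s, rfl⟩ := hrep r
  -- The cross terms of r² carry a factor 2 = ϖ². If c has residue zero, 2-independence of 𝔞, 𝔟
  -- kills the residues of x, y, z, w.
  refine ⟨x ^ 2 + a * y ^ 2 + b * (z ^ 2 + a * w ^ 2), ?_, fun h => ?_⟩
  · simp only [map_add, map_mul, map_pow, ← hα, ← hβ]
    generalize algebraMap O R x = x
    generalize algebraMap O R y = y
    generalize algebraMap O R z = z
    generalize algebraMap O R w = w
    refine ⟨ϖ * s ^ 2 + 2 * s * (x + α * y + β * (z + α * w)) +
      ϖ * (x * α * y + (x + α * y) * β * (z + α * w) + β ^ 2 * z * α * w), ?_⟩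
    linear_combination -(x * α * y + (x + α * y) * β * (z + α * w) + β ^ 2 * z * α * w) * hϖ
  · have h1 : residue O x = 0 ∧ residue O y = 0 ∧ residue O z = 0 ∧ residue O w = 0 :=
      independent (by simpa [ha, hb] using h)
    have hd : ∀ {c : O}, residue O c = 0 → ϖ ∣ algebraMap O R c :=
      fun h => dvd_of_residue_eq_zero hO hϖ h
    exact dvd_add (dvd_add (dvd_add (hd h1.1) (dvd_mul_of_dvd_right (hd h1.2.1) _))
      (dvd_mul_of_dvd_right (dvd_add (hd h1.2.2.1) (dvd_mul_of_dvd_right (hd h1.2.2.2) _)) _))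
      (dvd_mul_right _ _)

include hO ha hb hα hβ hϖ hunit hrep in
-- Squaring the form modulo ϖ replaces α, β by a, b and t², y², z² by elements of O, so the
-- anisotropic form over κ applies.
theorem dvd_of_form_dvd {t y z : R}
    (h : ϖ ∣ t ^ 2 + α * y ^ 2 + β * z ^ 2 + (1 + α) * (1 + β) * (y * z)) :
    ϖ ∣ t ∧ ϖ ∣ y ∧ ϖ ∣ z := by
  obtain ⟨ct, ht, ht'⟩ := exists_sq_congr hO ha hb hα hβ hϖ hrep t
  obtain ⟨cy, hy, hy'⟩ := exists_sq_congr hO ha hb hα hβ hϖ hrep y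
  obtain ⟨cz, hz, hz'⟩ := exists_sq_congr hO ha hb hα hβ hϖ hrep z
  have hdvd : ϖ ∣ algebraMap O R
      (ct ^ 2 + a * cy ^ 2 + b * cz ^ 2 + (1 + a) * (1 + b) * (cy * cz)) := by
    have h2 : ϖ ∣ 2 := ⟨ϖ, by rw [← hϖ]; ring⟩
    simp only [map_add, map_mul, map_pow, map_one, ← hα, ← hβ]
    simp only [← Ideal.mem_span_singleton, ← Ideal.Quotient.eq_zero_iff_mem, map_add, map_mul,
      map_sub, map_pow, map_one, map_ofNat] at ht hy hz h h2 ⊢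
    rw [← sub_eq_zero.mp ht, ← sub_eq_zero.mp hy, ← sub_eq_zero.mp hz]
    generalize Ideal.Quotient.mk (Ideal.span {ϖ}) t = t at h ⊢
    generalize Ideal.Quotient.mk (Ideal.span {ϖ}) y = y at h ⊢
    generalize Ideal.Quotient.mk (Ideal.span {ϖ}) z = z at h ⊢
    generalize Ideal.Quotient.mk (Ideal.span {ϖ}) α = α at h ⊢
    generalize Ideal.Quotient.mk (Ideal.span {ϖ}) β = β at h ⊢
    linear_combination (t ^ 2 + α * y ^ 2 + β * z ^ 2 + (1 + α) * (1 + β) * (y * z)) * h -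
      (t ^ 2 * (α * y ^ 2) + (t ^ 2 + α * y ^ 2) * (β * z ^ 2) +
        (t ^ 2 + α * y ^ 2 + β * z ^ 2) * ((1 + α) * (1 + β) * (y * z)) +
        (α * (1 + β ^ 2) + β * (1 + α ^ 2) + 2 * α * β) * (y ^ 2 * z ^ 2)) * h2
  have h0 := residue_eq_zero_of_dvd hunit hdvd
  simp only [map_add, map_mul, map_pow, map_one, ha, hb] at h0
  obtain ⟨h1, h3, h4⟩ := anisotropic h0
  exact ⟨ht' h1, hy' h3, hz' h4⟩

include hO ha hb hα hβ hϖ hunit hrep in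
/-- The quadratic form `x² - (1 + a) y² - (1 + b) z²` is anisotropic over `R`. -/
theorem ternary_anisotropic [IsDomain R] [WfDvdMonoid R] [CharZero R] {f : Fin 3 → R}
    (h : f 0 ^ 2 - (1 + α ^ 2) * f 1 ^ 2 - (1 + β ^ 2) * f 2 ^ 2 = 0) (i : Fin 3) : f i = 0 := by
  refine eq_zero_of_descent hunit (P := fun f =>
    f 0 ^ 2 - (1 + α ^ 2) * f 1 ^ 2 - (1 + β ^ 2) * f 2 ^ 2 = 0) (fun f hf => ?_) h i
  have h2 : (2 : R) ≠ 0 := two_ne_zero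
  have hϖ0 : ϖ ≠ 0 := by rintro rfl; exact h2 (by rw [← hϖ]; ring)
  -- Modulo ϖ the ternary form is the square of this linear form.
  obtain ⟨t, ht⟩ : ϖ ∣ f 0 - (1 + α) * f 1 - (1 + β) * f 2 := by
    obtain ⟨c, ⟨d, hc⟩, hc'⟩ := exists_sq_congr hO ha hb hα hβ hϖ hrep
      (f 0 - (1 + α) * f 1 - (1 + β) * f 2)
    refine hc' (residue_eq_zero_of_dvd hunit
      ⟨ϖ * ((1 + α + α ^ 2) * f 1 ^ 2 + (1 + β + β ^ 2) * f 2 ^ 2 - (1 + α) * f 1 * f 0 -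
        (1 + β) * f 2 * f 0 + (1 + α) * f 1 * (1 + β) * f 2) - d, ?_⟩)
    linear_combination -hc + hf - ((1 + α + α ^ 2) * f 1 ^ 2 + (1 + β + β ^ 2) * f 2 ^ 2 -
      (1 + α) * f 1 * f 0 - (1 + β) * f 2 * f 0 + (1 + α) * f 1 * (1 + β) * f 2) * hϖ
  -- After substitution for f₀ every term has a factor 2; the quotient differs from the form in t,
  -- f₁, f₂ by a multiple of ϖ.
  obtain ⟨⟨t', ht'⟩, ⟨y, hy⟩, z, hz⟩ := dvd_of_form_dvd hO ha hb hα hβ hϖ hunit hrep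
    (t := t) (y := f 1) (z := f 2) ⟨-(t * ((1 + α) * f 1 + (1 + β) * f 2)), by
      apply mul_left_cancel₀ h2
      have h0 : f 0 = ϖ * t + (1 + α) * f 1 + (1 + β) * f 2 := by linear_combination ht
      rw [h0] at hf
      linear_combination hf - t ^ 2 * hϖ⟩
  refine ⟨![ϖ * t' + (1 + α) * y + (1 + β) * z, y, z], ?_, ?_⟩
  · intro i
    fin_cases i
    · simp; linear_combination ht + ϖ * ht' + (1 + α) * hy + (1 + β) * hz
    · simpa using hy
    · simpa using hz
  · simp
    apply mul_left_cancel₀ (pow_ne_zero 2 hϖ0)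
    rw [mul_zero, ← hf, hy, hz, show f 0 = ϖ * (ϖ * t' + (1 + α) * y + (1 + β) * z) by
      linear_combination ht + ϖ * ht' + (1 + α) * hy + (1 + β) * hz]
    ring

end Descent

end RationalFunctions

/-! ### The order O[√a, √b, √2] in L -/

namespace RationalFunctions

open IsLocalRing

section Adjoin

variable {O A : Type*} [CommRing O] [CommRing A] [Algebra O A] {a b : O} {α β ϖ : A}

/-- Modulo ϖ the order is spanned over O by 1, α, β, αβ, a span closed under products because α² and
β² lie in O. -/
theorem adjoin_exists_rep (hα : α ^ 2 = algebraMap O A a) (hβ : β ^ 2 = algebraMap O A b)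
    {r : A} (hr : r ∈ Algebra.adjoin O {α, β, ϖ}) :
    ∃ (x y z w : O), ∃ s ∈ Algebra.adjoin O {α, β, ϖ}, r = algebraMap O A x +
      α * algebraMap O A y + β * (algebraMap O A z + α * algebraMap O A w) + ϖ * s := by
  have hmem : ∀ x : O, algebraMap O A x ∈ Algebra.adjoin O {α, β, ϖ} := fun x =>
    Subalgebra.algebraMap_mem _ x
  have hαm : α ∈ Algebra.adjoin O {α, β, ϖ} := Algebra.subset_adjoin (by simp)
  have hβm : β ∈ Algebra.adjoin O {α, β, ϖ} := Algebra.subset_adjoin (by simp)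
  have hϖm : ϖ ∈ Algebra.adjoin O {α, β, ϖ} := Algebra.subset_adjoin (by simp)
  induction hr using Algebra.adjoin_induction with
  | mem r hr =>
    rcases hr with rfl | rfl | rfl
    · exact ⟨0, 1, 0, 0, 0, zero_mem _, by simp⟩
    · exact ⟨0, 0, 1, 0, 0, zero_mem _, by simp⟩
    · exact ⟨0, 0, 0, 0, 1, one_mem _, by simp⟩
  | algebraMap c => exact ⟨c, 0, 0, 0, 0, zero_mem _, by simp⟩
  | add r r' _ _ h h' =>
    obtain ⟨x, y, z, w, s, hs, rfl⟩ := h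
    obtain ⟨x', y', z', w', s', hs', rfl⟩ := h'
    refine ⟨x + x', y + y', z + z', w + w', s + s', add_mem hs hs', ?_⟩
    simp only [map_add]
    ring
  | mul r r' _ _ h h' =>
    obtain ⟨x, y, z, w, s, hs, rfl⟩ := h
    obtain ⟨x', y', z', w', s', hs', rfl⟩ := h'
    refine ⟨x * x' + a * (y * y') + b * (z * z') + a * b * (w * w'),
      x * y' + y * x' + b * (z * w' + w * z'), x * z' + z * x' + a * (y * w' + w * y'),
      x * w' + w * x' + y * z' + z * y',
      (algebraMap O A x + α * algebraMap O A y + β * (algebraMap O A z + α * algebraMap O A w)) *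
        s' + s * (algebraMap O A x' + α * algebraMap O A y' +
          β * (algebraMap O A z' + α * algebraMap O A w') + ϖ * s'), ?_, ?_⟩
    · have hE : ∀ x y z w : O, algebraMap O A x + α * algebraMap O A y +
          β * (algebraMap O A z + α * algebraMap O A w) ∈ Algebra.adjoin O {α, β, ϖ} :=
        fun x y z w => add_mem (add_mem (hmem x) (mul_mem hαm (hmem y)))
          (mul_mem hβm (add_mem (hmem z) (mul_mem hαm (hmem w))))
      exact add_mem (mul_mem (hE _ _ _ _) hs')
        (mul_mem hs (add_mem (hE _ _ _ _) (mul_mem hϖm hs')))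
    · simp only [map_add, map_mul, ← hα, ← hβ]
      ring

theorem exists_mul_mem_adjoin {O K L : Type*} [CommRing O] [IsDomain O] [Field K] [Algebra O K]
    [IsFractionRing O K] [Field L] [Algebra K L] [Algebra O L] [IsScalarTower O K L] {S : Set L}
    {x : L} (hx : x ∈ Algebra.adjoin K S) :
    ∃ g : O, g ≠ 0 ∧ algebraMap O L g * x ∈ Algebra.adjoin O S := by
  induction hx using Algebra.adjoin_induction with
  | mem x hx => exact ⟨1, one_ne_zero, by simpa using Algebra.subset_adjoin hx⟩
  | algebraMap c =>
    obtain ⟨f, g, hg, rfl⟩ := IsFractionRing.div_surjective (A := O) c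
    have hg0 : algebraMap O K g ≠ 0 := IsFractionRing.to_map_ne_zero_of_mem_nonZeroDivisors hg
    refine ⟨g, nonZeroDivisors.ne_zero hg, ?_⟩
    rw [IsScalarTower.algebraMap_apply O K L, ← map_mul, mul_div_cancel₀ _ hg0,
      ← IsScalarTower.algebraMap_apply]
    exact Subalgebra.algebraMap_mem _ f
  | add x y _ _ h h' =>
    obtain ⟨g, hg, hx⟩ := h
    obtain ⟨g', hg', hy⟩ := h'
    refine ⟨g * g', mul_ne_zero hg hg', ?_⟩
    have : algebraMap O L (g * g') * (x + y) = algebraMap O L g' * (algebraMap O L g * x) +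
        algebraMap O L g * (algebraMap O L g' * y) := by rw [map_mul]; ring
    rw [this]
    exact add_mem (mul_mem (Subalgebra.algebraMap_mem _ _) hx)
      (mul_mem (Subalgebra.algebraMap_mem _ _) hy)
  | mul x y _ _ h h' =>
    obtain ⟨g, hg, hx⟩ := h
    obtain ⟨g', hg', hy⟩ := h'
    refine ⟨g * g', mul_ne_zero hg hg', ?_⟩
    have : algebraMap O L (g * g') * (x * y) = (algebraMap O L g * x) * (algebraMap O L g' * y) := by
      rw [map_mul]; ring
    rw [this]
    exact mul_mem hx hy

end Adjoin

/-- Over `L = K(√a, √b, √2)`, the unit `1 + b` is not a norm from `L(√(1 + a))`. -/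
theorem not_norm {O K L : Type*} [CommRing O] [IsDomain O] [IsDiscreteValuationRing O] [CharZero O]
    [Algebra (MvPolynomial (Fin 2) (ZMod 2)) (ResidueField O)]
    [IsFractionRing (MvPolynomial (Fin 2) (ZMod 2)) (ResidueField O)]
    (h2 : Irreducible (2 : O)) {a b : O}
    (ha : residue O a = algebraMap (MvPolynomial (Fin 2) (ZMod 2)) _ (MvPolynomial.X 0))
    (hb : residue O b = algebraMap (MvPolynomial (Fin 2) (ZMod 2)) _ (MvPolynomial.X 1))
    [Field K] [Algebra O K] [IsFractionRing O K] [Field L] [Algebra K L] [Algebra O L]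
    [IsScalarTower O K L] {α β ϖ : L} (hα : α ^ 2 = algebraMap O L a)
    (hβ : β ^ 2 = algebraMap O L b) (hϖ : ϖ ^ 2 = 2)
    (hL : IntermediateField.adjoin K {α, β, ϖ} = ⊤) (x y : L) :
    x ^ 2 - (1 + algebraMap O L a) * y ^ 2 ≠ 1 + algebraMap O L b := by
  have hinj : Function.Injective (algebraMap O L) := by
    rw [IsScalarTower.algebraMap_eq O K L]
    exact (algebraMap K L).injective.comp (IsFractionRing.injective O K)
  have hint : ∀ z ∈ ({α, β, ϖ} : Set L), IsIntegral O z := by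
    rintro z (rfl | rfl | rfl)
    · exact IsIntegral.of_pow two_pos (hα ▸ isIntegral_algebraMap)
    · exact IsIntegral.of_pow two_pos (hβ ▸ isIntegral_algebraMap)
    · refine IsIntegral.of_pow two_pos ?_
      rw [hϖ, ← map_ofNat (algebraMap O L)]
      exact isIntegral_algebraMap
  have halg : Algebra.adjoin K {α, β, ϖ} = ⊤ := by
    rw [← IntermediateField.adjoin_toSubalgebra_of_isAlgebraic fun z hz =>
      ((hint z hz).tower_top (A := K)).isAlgebraic, hL, IntermediateField.top_toSubalgebra]
  let R : Subalgebra O L := Algebra.adjoin O {α, β, ϖ}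
  have : IsNoetherian O R :=
    -- Noetherianity of R is what makes infinite descent stop.
    isNoetherian_of_fg_of_noetherian _ (fg_adjoin_of_finite (Set.toFinite _) hint)
  have : IsNoetherianRing R := isNoetherian_of_tower O this
  have : Algebra.IsIntegral O R := Algebra.IsIntegral.of_finite O R
  have hinjR : Function.Injective (algebraMap O R) := fun u v h => hinj (congrArg Subtype.val h)
  have : FaithfulSMul O R := (faithfulSMul_iff_algebraMap_injective O R).mpr hinjR
  have : CharZero R := charZero_of_injective_algebraMap hinjR
  let α' : R := ⟨α, Algebra.subset_adjoin (by simp)⟩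
  let β' : R := ⟨β, Algebra.subset_adjoin (by simp)⟩
  let ϖ' : R := ⟨ϖ, Algebra.subset_adjoin (by simp)⟩
  have hα' : α' ^ 2 = algebraMap O R a := Subtype.ext hα
  have hβ' : β' ^ 2 = algebraMap O R b := Subtype.ext hβ
  have hϖ' : ϖ' ^ 2 = 2 := Subtype.ext hϖ
  -- Otherwise 2 = ϖ² would be a unit in R, hence in O since R is integral over O.
  have hunit : ¬ IsUnit ϖ' := fun h => by
    have h1 := h.pow 2
    rw [hϖ', ← map_ofNat (algebraMap O R)] at h1
    exact h2.not_isUnit (isUnit_of_map_unit (algebraMap O R) _ h1)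
  have hrep : ∀ r : R, ∃ (x y z w : O) (s : R), r = algebraMap O R x + α' * algebraMap O R y +
      β' * (algebraMap O R z + α' * algebraMap O R w) + ϖ' * s := fun r => by
    obtain ⟨x, y, z, w, s, hs, h⟩ := adjoin_exists_rep hα hβ r.2
    exact ⟨x, y, z, w, ⟨s, hs⟩, Subtype.ext h⟩
  intro h
  obtain ⟨g, hg, hx⟩ := exists_mul_mem_adjoin (O := O) (x := x) (halg ▸ Algebra.mem_top)
  obtain ⟨g', hg', hy⟩ := exists_mul_mem_adjoin (O := O) (x := y) (halg ▸ Algebra.mem_top)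
  -- The zero (x, y, 1) is scaled by gg' into R; its last coordinate gg' is nonzero.
  have h0 := ternary_anisotropic h2.maximalIdeal_eq ha hb hα' hβ' hϖ' hunit hrep
    (f := ![algebraMap O R g' * ⟨_, hx⟩, algebraMap O R g * ⟨_, hy⟩, algebraMap O R (g * g')]) (by
      apply Subtype.ext
      change (algebraMap O L g' * (algebraMap O L g * x)) ^ 2 -
        (1 + α ^ 2) * (algebraMap O L g * (algebraMap O L g' * y)) ^ 2 -
        (1 + β ^ 2) * (algebraMap O L (g * g')) ^ 2 = 0
      rw [hα, hβ, map_mul]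
      linear_combination (algebraMap O L g * algebraMap O L g') ^ 2 * h) 2
  exact mul_ne_zero hg hg' (hinjR (by simpa using h0))

end RationalFunctions

/-! ### Pseudo-perfectness and the nonzero restriction -/

theorem mainTheorem9
    {O K L : Type*}
    [CommRing O] [IsDomain O] [IsDiscreteValuationRing O]
    [IsAdicComplete (IsLocalRing.maximalIdeal O) O]
    [CharZero O] [CharP (IsLocalRing.ResidueField O) 2]
    (h2 : Irreducible (2 : O))
    [Field K] [Algebra O K] [IsFractionRing O K]
    (e : FractionRing (MvPolynomial (Fin 2) (ZMod 2)) ≃+* IsLocalRing.ResidueField O)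
    (a b : O)
    (ha : IsLocalRing.residue O a =
      e (algebraMap (MvPolynomial (Fin 2) (ZMod 2)) _ (MvPolynomial.X 0)))
    (hb : IsLocalRing.residue O b =
      e (algebraMap (MvPolynomial (Fin 2) (ZMod 2)) _ (MvPolynomial.X 1)))
    [Field L] [Algebra K L]
    (sqrta sqrtb sqrt2 : L)
    (hsa : sqrta ^ 2 = algebraMap K L (algebraMap O K a))
    (hsb : sqrtb ^ 2 = algebraMap K L (algebraMap O K b))
    (hs2 : sqrt2 ^ 2 = 2)
    (hL : IntermediateField.adjoin K {sqrta, sqrtb, sqrt2} = ⊤) :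
    IsPseudoPerfect 2 1 O K L ∧
    MilnorK2Mod.res 2 K L ≠ 0 ∧
    ∃ (ha1 : 1 + algebraMap O K a ≠ 0) (hb1 : 1 + algebraMap O K b ≠ 0),
      MilnorK2Mod.res 2 K L
        (MilnorK2Mod.symbol 2 (Units.mk0 (1 + algebraMap O K a) ha1)
          (Units.mk0 (1 + algebraMap O K b) hb1)) ≠ 0 := by
  let _ : Algebra (MvPolynomial (Fin 2) (ZMod 2)) (IsLocalRing.ResidueField O) :=
    (e.toRingHom.comp (algebraMap _ _)).toAlgebra
  have : IsFractionRing (MvPolynomial (Fin 2) (ZMod 2)) (IsLocalRing.ResidueField O) :=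
    IsLocalization.isLocalization_of_algEquiv _ (AlgEquiv.ofRingEquiv (f := e) fun _ => rfl)
  let _ : Algebra O L := ((algebraMap K L).comp (algebraMap O K)).toAlgebra
  have : IsScalarTower O K L := IsScalarTower.of_algebraMap_eq fun _ => rfl
  have : CharZero K := charZero_of_injective_algebraMap (IsFractionRing.injective O K)
  have : CharZero L := charZero_of_injective_algebraMap (algebraMap K L).injective
  have hne : ∀ (c : O) (i : Fin 2), IsLocalRing.residue O c =
      algebraMap (MvPolynomial (Fin 2) (ZMod 2)) _ (MvPolynomial.X i) →
      1 + algebraMap O K c ≠ 0 := by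
    intro c i hc h
    have h1 : 1 + c = 0 := IsFractionRing.injective O K (by simpa using h)
    have h3 : (1 + MvPolynomial.X i : MvPolynomial (Fin 2) (ZMod 2)) = 0 :=
      IsFractionRing.injective _ (IsLocalRing.ResidueField O) (by
        rw [map_add, map_one, ← hc, ← map_one (IsLocalRing.residue O), ← map_add, h1, map_zero,
          map_zero])
    -- 1 + Xᵢ has constant term 1.
    simpa using congrArg MvPolynomial.constantCoeff h3
  have hsymb : MilnorK2Mod.res 2 K L
      (MilnorK2Mod.symbol 2 (Units.mk0 (1 + algebraMap O K a) (hne a 0 ha))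
        (Units.mk0 (1 + algebraMap O K b) (hne b 1 hb))) ≠ 0 := by
    intro h
    obtain ⟨x, y, hxy⟩ := QuadraticCocycle.exists_norm_eq_of_symbol_eq_zero
      (A := Units.map (algebraMap K L : K →* L) (Units.mk0 _ (hne a 0 ha)))
      (B := Units.map (algebraMap K L : K →* L) (Units.mk0 _ (hne b 1 hb))) h
    refine RationalFunctions.not_norm h2 ha hb hsa hsb hs2 hL x y ?_
    simpa [IsScalarTower.algebraMap_apply O K L] using hxy
  refine ⟨?_, fun h => hsymb (by rw [h]; rfl), hne a 0 ha, hne b 1 hb, hsymb⟩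
  refine ⟨2, 1, ![a, b], ![2], ⟨?_, ?_, ?_⟩, ![sqrta, sqrtb], ![sqrt2], ?_, ?_, ?_⟩
  · have : (fun i => IsLocalRing.residue O (![a, b] i)) = fun i : Fin 2 =>
        algebraMap (MvPolynomial (Fin 2) (ZMod 2)) (IsLocalRing.ResidueField O)
          (MvPolynomial.X i) := by
      funext i
      fin_cases i
      · exact ha
      · exact hb
    rw [this]
    exact RationalFunctions.isPBasis
  · rw [h2.maximalIdeal_eq]
    simp
  · simpa using IsDiscreteValuationRing.ringKrullDim_eq_one O
  · intro i
    fin_cases i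
    · simpa using hsa
    · simpa using hsb
  · intro j
    fin_cases j
    simpa [map_ofNat] using hs2
  · rw [← hL]
    congr 1
    ext z
    simp only [Matrix.range_cons, Matrix.range_empty, Set.union_empty, Set.mem_union,
      Set.mem_insert_iff, Set.mem_singleton_iff, or_assoc]
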